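/- Let $\mathbb D=\{z\in\mathbb C:|z|<1\}$. For $0<a\le 1$ let $\mathcal D_a$ be the reproducing kernel Hilbert space of functions on $\mathbb D$ with kernel $k_a(z,w)=(1-z\overline w)^{-a}$ (principal branch). A function $\varphi:\mathbb D\to\mathbb C$ is a multiplier of $\mathcal D_a$ if $\varphi f\in\mathcal D_a$ for all $f\in\mathcal D_a$, and its multiplier norm is $\sup\{\|\varphi f\|:\|f\|\le 1\}$. A set $Z\subset\mathbb D$ is *strongly separated for $\mathcal D_a$* if there is $\varepsilon>0$ such that for every $z\in Z$ there is a multiplier $\varphi$ of $\mathcal D_a$ of multiplier norm at most one with $\varphi(z)=\varepsilon$ and $\varphi(u)=0$ for all $u\in Z\setminus\{z\}$. A proper subset $Z\subsetneq\mathbb D$ is a *zero set for $\mathcal D_a$* if there is $f\in\mathcal D_a\setminus\{0\}$ with $Z=\{z\in\mathbb D: f(z)=0\}$. A *Fuchsian group* is a discrete subgroup of the group $\operatorname{Aut}(\mathbb D)$ of biholomorphic automorphisms of $\mathbb D$ (with the topology of locally uniform convergence). **Proposition.** Let $0<a\le 1$, let $G$ be a Fuchsian group, let $w\in\mathbb D$,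 and let $Z=\{\theta(w):\theta\in G\}$ be the orbit of $w$ under $G$. The following are equivalent: (i) $Z$ is a zero set for $\mathcal D_a$; (ii) $Z$ is strongly separated for $\mathcal D_a$. -/

import Mathlib

open scoped Complex.UnitDisc NNReal

noncomputable section

namespace FuchsianZero

open Complex RKHS Set
open scoped ENNReal ComplexConjugate

/-! ## The weighted Dirichlet spaces -/

/-- The kernel `k_a(z, w) = 1 / (1 - z w̄) ^ a` on the unit disc (principal branch; `1 - z w̄` has
positive real part). -/
def dirichletKernel (a : ℝ≥0) (z w : 𝔻) : ℂ :=
  1 / (1 - (z : ℂ) * conj (w : ℂ)) ^ ((a : ℝ) : ℂ)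

/-- The kernel `k_a` as an operator-valued kernel: `k_a(z, w)` acts on `ℂ` by multiplication. -/
def dirichletKernelOp (a : ℝ≥0) : Matrix 𝔻 𝔻 (ℂ →L[ℂ] ℂ) :=
  Matrix.of fun z w => dirichletKernel a z w • ContinuousLinearMap.id ℂ ℂ

theorem choose_nonneg (a : ℝ≥0) (n : ℕ) : 0 ≤ Ring.choose ((a : ℝ) + n - 1) n := by
  have h2 : 0 ≤ (ascPochhammer ℝ n).eval (a : ℝ) := by
    induction n with
    | zero => simp
    | succ n ih =>
      rw [ascPochhammer_succ_right]
      simp only [Polynomial.eval_mul, Polynomial.eval_add, Polynomial.eval_X,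
        Polynomial.eval_natCast]
      exact mul_nonneg ih (by positivity)
  have h := Ring.factorial_nsmul_multichoose_eq_ascPochhammer (a : ℝ) n
  rw [Polynomial.ascPochhammer_smeval_eq_eval] at h
  have h3 : Ring.choose ((a : ℝ) + n - 1) n = Ring.multichoose (a : ℝ) n := by
    unfold Ring.choose
    congr 1
    ring
  rw [h3]
  rw [← h, nsmul_eq_mul] at h2
  exact nonneg_of_mul_nonneg_right h2 (by positivity)

theorem hasSum_dirichletKernel (a : ℝ≥0) (z w : 𝔻) :
    HasSum (fun n : ℕ => ((Ring.choose ((a : ℝ) + n - 1) n : ℝ) : ℂ) *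
      ((z : ℂ) * conj (w : ℂ)) ^ n) (dirichletKernel a z w) := by
  have hlt : ‖(z : ℂ) * conj (w : ℂ)‖ < 1 := by
    rw [norm_mul, RCLike.norm_conj]
    exact mul_lt_one_of_nonneg_of_lt_one_left (norm_nonneg _) z.norm_lt_one w.norm_lt_one.le
  have h := (Complex.one_div_one_sub_cpow_hasFPowerSeriesOnBall_zero ((a : ℝ) : ℂ)).hasSum
    (y := (z : ℂ) * conj (w : ℂ)) (by
      rw [← ENNReal.ofReal_one, Metric.eball_ofReal]
      simpa using hlt)
  convert! h using 1
  · funext n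
    simp [FormalMultilinearSeries.ofScalars, Complex.ofReal_choose]
  · simp [dirichletKernel]

theorem posSemidef_dirichletKernelOp (a : ℝ≥0) : (dirichletKernelOp a).PosSemidef := by
  have htfae := posSemidef_tfae (K := dirichletKernelOp a)
  simp only [List.tfae_cons_cons, List.tfae_singleton, and_true] at htfae
  refine (htfae.1.trans htfae.2).mpr ⟨?_, fun v => ?_⟩
  · ext z w
    have : conj (dirichletKernel a w z) = dirichletKernel a z w := by
      have h := ((hasSum_dirichletKernel a w z).map (starRingEnd ℂ) Complex.continuous_conj)
      refine h.unique ?_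
      convert! hasSum_dirichletKernel a z w using 1
      funext n
      simp [mul_comm]
    have hid : ContinuousLinearMap.adjoint (ContinuousLinearMap.id ℂ ℂ) =
        ContinuousLinearMap.id ℂ ℂ := star_one (ℂ →L[ℂ] ℂ)
    simp [dirichletKernelOp, Matrix.conjTranspose_apply, ContinuousLinearMap.star_eq_adjoint,
      this, hid]
  · have key : HasSum (fun n : ℕ => Ring.choose ((a : ℝ) + n - 1) n *
        ‖∑ x ∈ v.support, conj ((x : ℂ)) ^ n * v x‖ ^ 2)
        (RCLike.re (v.sum fun x w => v.sum fun x' w' =>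
          inner ℂ (dirichletKernelOp a x' x w) w')) := by
      have h1 : HasSum (fun n : ℕ => ∑ x ∈ v.support, ∑ x' ∈ v.support,
          conj (((Ring.choose ((a : ℝ) + n - 1) n : ℝ) : ℂ) *
            ((x' : ℂ) * conj (x : ℂ)) ^ n * v x) * v x')
          (v.sum fun x w => v.sum fun x' w' =>
            inner ℂ (dirichletKernelOp a x' x w) w') := by
        unfold Finsupp.sum
        refine hasSum_sum fun x _ => hasSum_sum fun x' _ => ?_
        have h := (((hasSum_dirichletKernel a x' x).mul_right (v x)).map (starRingEnd ℂ)
          Complex.continuous_conj).mul_right (v x')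
        convert! h using 1
        simp [dirichletKernelOp]
        ring
      have h2 := h1.mapL Complex.reCLM
      convert! h2 using 1
      funext n
      have h3 : ∑ x ∈ v.support, ∑ x' ∈ v.support,
          conj (((Ring.choose ((a : ℝ) + n - 1) n : ℝ) : ℂ) *
            ((x' : ℂ) * conj (x : ℂ)) ^ n * v x) * v x' =
          ((Ring.choose ((a : ℝ) + n - 1) n *
            ‖∑ x ∈ v.support, conj ((x : ℂ)) ^ n * v x‖ ^ 2 : ℝ) : ℂ) := by
        rw [Complex.ofReal_mul, Complex.ofReal_pow, ← Complex.conj_mul', map_sum,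
          Finset.sum_mul_sum, Finset.mul_sum]
        refine Finset.sum_congr rfl fun x _ => ?_
        rw [Finset.mul_sum]
        refine Finset.sum_congr rfl fun x' _ => ?_
        simp only [map_mul, map_pow, Complex.conj_ofReal, Complex.conj_conj, mul_pow]
        ring
      rw [h3]
      exact (Complex.ofReal_re _).symm
    exact key.nonneg fun n => mul_nonneg (choose_nonneg a n) (by positivity)

instance (a : ℝ≥0) : Fact (dirichletKernelOp a).PosSemidef := ⟨posSemidef_dirichletKernelOp a⟩

/-- The standard weighted Dirichlet space `D_a`: the reproducing kernel Hilbert space of functions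
on the unit disc whose kernel is `k_a`. -/
abbrev DirichletSpace (a : ℝ≥0) : Type := RKHS.OfKernel (dirichletKernelOp a)

/-- The kernel function at `w` is `k_a(·, w)`, and it reproduces the value at `w`. -/
theorem reproducing_dirichletKernel (a : ℝ≥0) (w : 𝔻) :
    ∃ k : DirichletSpace a, (∀ z, k z = dirichletKernel a z w) ∧
      ∀ f : DirichletSpace a, inner ℂ k f = f w := by
  refine ⟨kerFun (DirichletSpace a) w 1, fun z => ?_, fun f => ?_⟩
  · rw [kerFun_apply, OfKernel.kernel_ofKernel]
    simp [dirichletKernelOp]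
  · simp

/-! ## Multipliers, strong separation and zero sets -/

section RKHS

variable {X : Type*} (H : Type*) [NormedAddCommGroup H] [InnerProductSpace ℂ H] [RKHS ℂ H X ℂ]

/-- `φ` is a multiplier of `H`: `φ f` belongs to `H` for every `f` in `H`. -/
def IsMultiplier (φ : X → ℂ) : Prop :=
  ∀ f : H, ∃ g : H, ∀ z, g z = φ z * f z

/-- The multiplier norm `sup {‖φ f‖ : ‖f‖ ≤ 1}`, as an extended non-negative real. -/
def multiplierNorm (φ : X → ℂ) : ℝ≥0∞ :=
  sSup {r | ∃ f g : H, ‖f‖ ≤ 1 ∧ (∀ z, g z = φ z * f z) ∧ r = ‖g‖ₑ}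

/-- The set `Z` of points is strongly separated for `H`: for some `ε > 0`, each point `z` of `Z`
admits a multiplier of norm at most one with value `ε` at `z` and `0` at all other points of `Z`. -/
def IsStronglySeparated (Z : Set X) : Prop :=
  ∃ ε : ℝ, 0 < ε ∧ ∀ z ∈ Z, ∃ φ : X → ℂ,
    IsMultiplier H φ ∧ multiplierNorm H φ ≤ 1 ∧ φ z = ε ∧ ∀ u ∈ Z, u ≠ z → φ u = 0

/-- The proper subset `Z` of `X` is the set of zeros of some non-zero element of `H`. -/
def IsZeroSet (Z : Set X) : Prop :=
  Z ≠ univ ∧ ∃ f : H, f ≠ 0 ∧ Z = {z | f z = 0}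

end RKHS

/-! ## Fuchsian groups -/

/-- A self-map of the unit disc is holomorphic. -/
def IsHolomorphic (f : 𝔻 → 𝔻) : Prop :=
  ∃ F : ℂ → ℂ, DifferentiableOn ℂ F (Metric.ball 0 1) ∧ ∀ z : 𝔻, F z = f z

theorem IsHolomorphic.comp {f g : 𝔻 → 𝔻} (hf : IsHolomorphic f) (hg : IsHolomorphic g) :
    IsHolomorphic (f ∘ g) := by
  obtain ⟨F, hF, hFf⟩ := hf
  obtain ⟨G, hG, hGg⟩ := hg
  refine ⟨F ∘ G, hF.comp hG fun z hz => ?_, fun z => by simp [hGg, hFf]⟩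
  have h := hGg (UnitDisc.mk z (by simpa using hz))
  rw [UnitDisc.coe_mk] at h
  rw [h]
  simpa using UnitDisc.norm_lt_one _

/-- The group `Aut(𝔻)` of biholomorphic automorphisms of the unit disc, under composition. -/
def discAut : Subgroup (𝔻 ≃ₜ 𝔻) where
  carrier := {θ | IsHolomorphic θ ∧ IsHolomorphic θ.symm}
  mul_mem' hθ hη := ⟨hθ.1.comp hη.1, hη.2.comp hθ.2⟩
  one_mem' := ⟨⟨id, differentiableOn_id, fun _ => rfl⟩, ⟨id, differentiableOn_id, fun _ => rfl⟩⟩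
  inv_mem' hθ := ⟨hθ.2, hθ.1⟩

/-- The topology of `Aut(𝔻)`: locally uniform convergence, that is, the topology induced by the
compact-open topology on the continuous self-maps of the disc. -/
instance : TopologicalSpace discAut :=
  TopologicalSpace.induced (fun θ => (⟨θ.1, θ.1.continuous⟩ : C(𝔻, 𝔻))) inferInstance

/-- A Fuchsian group is a discrete subgroup of `Aut(𝔻)`. -/
def IsFuchsian (G : Subgroup discAut) : Prop :=
  DiscreteTopology G

/-- The orbit `{θ(w) : θ ∈ G}` of the point `w`, as a set. -/
def orbit (G : Subgroup discAut) (w : 𝔻) : Set 𝔻 :=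
  {z | ∃ θ ∈ G, (θ : 𝔻 ≃ₜ 𝔻) w = z}

end FuchsianZero

end

noncomputable section

namespace FuchsianZero

open Complex RKHS Set
open scoped ENNReal ComplexConjugate

/-! Two properties of `D_a` carry the proof. First, zeros can be divided out: if `f p = 0`, then `f
= moebius p * g` with `‖g‖ ≤ ‖f‖` (`exists_eq_moebius_mul`). Second, for `a ≤ 1` the kernel `1 - 1 /
k_a` has non-negative Taylor coefficients (the complete Pick property), so the normalized extremal
function of the subspace vanishing on a set is a contractive multiplier (`isContractive_extremal`).
Both are moved around the disc by automorphisms, since `k_a` is conformally invariant up to a weight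
(`IsConformal.weight_mul`).

Zero set implies strongly separated: take `f ≠ 0` vanishing on the orbit and divide out its zero at
`w` until the quotient is non-zero there, keeping the zeros at the other orbit points. The Pick
property turns this quotient into a contractive multiplier with some value `ε > 0` at `w`.
Composition with elements of the group carries it to every other orbit point with the same `ε`.

Strongly separated implies zero set: a multiplier `φ` separating `w` lies in `D_a`, because
constants do, and `(z - w) φ` is a non-zero function vanishing on the orbit. The extremal function
of the vanishing subspace at a point `v` where this function is non-zero has no further zeros:
dividing one out would give a competitor of no larger norm and larger modulus at `v`.

Operators on `D_a` are never built directly. A function is shown to lie in the space, with a norm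
bound, by comparing Gram forms of kernel functions. -/

/-! ## Transfer between feature maps -/

/-- If the feature map `Φ` is dominated by `Ψ`, then every function represented by `Φ` is
represented by `Ψ`, with a vector of no larger norm. -/
theorem exists_inner_eq_of_norm_sum_le {X : Type} {E F : Type*}
    [NormedAddCommGroup E] [InnerProductSpace ℂ E]
    [NormedAddCommGroup F] [InnerProductSpace ℂ F] [CompleteSpace F] {Φ : X → E} {Ψ : X → F}
    (h : ∀ (ι : Type) [Fintype ι] (x : ι → X) (c : ι → ℂ),
      ‖∑ i, c i • Φ (x i)‖ ^ 2 ≤ ‖∑ i, c i • Ψ (x i)‖ ^ 2) (e : E) :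
    ∃ f : F, (∀ x, inner ℂ (Ψ x) f = inner ℂ (Φ x) e) ∧ ‖f‖ ≤ ‖e‖ := by
  have h' : ∀ v : X →₀ ℂ,
      ‖Finsupp.linearCombination ℂ Φ v‖ ≤ ‖Finsupp.linearCombination ℂ Ψ v‖ := by
    intro v
    have := h v.support (fun i => i) (fun i => v i)
    rw [Finset.sum_coe_sort v.support (fun i => v i • Φ i),
      Finset.sum_coe_sort v.support (fun i => v i • Ψ i)] at this
    exact (sq_le_sq₀ (norm_nonneg _) (norm_nonneg _)).1 this
  set A := Finsupp.linearCombination ℂ Ψ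
  set B := Finsupp.linearCombination ℂ Φ
  obtain ⟨s, hs⟩ := A.rangeRestrict.exists_rightInverse_of_surjective A.range_rangeRestrict
  have hs' : ∀ u, A (s u) = u := fun u => congrArg Subtype.val (LinearMap.congr_fun hs u)
  have hB : ∀ u, ‖B (s u)‖ ≤ ‖u‖ := fun u => by simpa [hs'] using h' (s u)
  -- `s` is only a linear section of `A`. The vectors `s (A v)` and `v` have the same image under
  -- `A`, so the domination forces the same image under `B`, and the choice of `s` is immaterial.
  have hBA : ∀ v, B (s (A.rangeRestrict v)) = B v := by
    intro v
    have := h' (s (A.rangeRestrict v) - v)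
    rw [map_sub, map_sub, hs'] at this
    simpa [sub_eq_zero] using this
  -- The functional `A v ↦ ⟪e, B v⟫` on the span of the `Ψ x` has norm at most `‖e‖`. A Hahn–Banach
  -- extension and Riesz representation then give `f`.
  let ℓ : StrongDual ℂ (LinearMap.range A) :=
    ((innerSL ℂ e).toLinearMap ∘ₗ B ∘ₗ s).mkContinuous ‖e‖ fun u => by
      simpa using (norm_inner_le_norm (𝕜 := ℂ) e (B (s u))).trans
        (mul_le_mul_of_nonneg_left (hB u) (norm_nonneg _))
  obtain ⟨g, hg, hgn⟩ := exists_extension_norm_eq (𝕜 := ℂ) (LinearMap.range A) ℓ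
  refine ⟨(InnerProductSpace.toDual ℂ F).symm g, fun x => ?_, ?_⟩
  · have h1 := hg (A.rangeRestrict (Finsupp.single x 1))
    have h2 : ℓ (A.rangeRestrict (Finsupp.single x 1)) = inner ℂ e (Φ x) := by
      change inner ℂ e (B (s _)) = _
      rw [hBA]
      simp [B]
    rw [h2] at h1
    rw [← inner_conj_symm, InnerProductSpace.toDual_symm_apply, ← inner_conj_symm (Φ x), ← h1]
    simp [A]
  · rw [LinearIsometryEquiv.norm_map, hgn]
    exact LinearMap.mkContinuous_norm_le _ (norm_nonneg _) _

/-! ## Hermitian forms attached to kernels -/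

section Form

variable {X ι : Type*} [Fintype ι]

/-- The real part of the sesquilinear form of the kernel `N` on the family of points `x`. -/
def form (N : X → X → ℂ) (x : ι → X) (c : ι → ℂ) : ℝ :=
  (∑ i, ∑ j, conj (c i) * c j * N (x i) (x j)).re

theorem form_inner {E : Type*} [NormedAddCommGroup E] [InnerProductSpace ℂ E] (Φ : X → E)
    (x : ι → X) (c : ι → ℂ) :
    form (fun x y => inner ℂ (Φ x) (Φ y)) x c = ‖∑ i, c i • Φ (x i)‖ ^ 2 := by
  rw [← inner_self_eq_norm_sq (𝕜 := ℂ), sum_inner]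
  simp only [inner_sum, inner_smul_left, inner_smul_right, form]
  change _ = Complex.re _
  congr 1
  exact Finset.sum_congr rfl fun i _ => Finset.sum_congr rfl fun j _ => by ring

theorem form_sub (N N' : X → X → ℂ) (x : ι → X) (c : ι → ℂ) :
    form (fun x y => N x y - N' x y) x c = form N x c - form N' x c := by
  simp [form, mul_sub, Finset.sum_sub_distrib]

theorem form_real_mul (r : ℝ) (N : X → X → ℂ) (x : ι → X) (c : ι → ℂ) :
    form (fun x y => r * N x y) x c = r * form N x c := by
  rw [form, form, ← Complex.re_ofReal_mul, Finset.mul_sum]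
  simp only [Finset.mul_sum]
  congr 1
  exact Finset.sum_congr rfl fun i _ => Finset.sum_congr rfl fun j _ => by ring

theorem form_conj_mul (h : X → ℂ) (N : X → X → ℂ) (x : ι → X) (c : ι → ℂ) :
    form (fun x y => h x * conj (h y) * N x y) x c = form N x fun i => c i * conj (h (x i)) := by
  simp only [form, map_mul, Complex.conj_conj]
  congr 1
  exact Finset.sum_congr rfl fun i _ => Finset.sum_congr rfl fun j _ => by ring

theorem form_one (x : ι → X) (c : ι → ℂ) : form (fun _ _ => 1) x c = ‖∑ i, c i‖ ^ 2 := by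
  rw [← Complex.ofReal_re (‖∑ i, c i‖ ^ 2), Complex.ofReal_pow, ← Complex.conj_mul', map_sum,
    Finset.sum_mul_sum]
  simp [form]

/-- The form of a product of a kernel with a power series kernel. -/
theorem hasSum_form_mul {coef : ℕ → ℝ} {t : X → ℂ} {K : X → X → ℂ}
    (hK : ∀ x y, HasSum (fun n => (coef n : ℂ) * (t x * conj (t y)) ^ n) (K x y))
    (N : X → X → ℂ) (x : ι → X) (c : ι → ℂ) :
    HasSum (fun n => coef n * form N x fun i => c i * conj (t (x i)) ^ n)
      (form (fun x y => K x y * N x y) x c) := by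
  have h1 : HasSum (fun n => ∑ i, ∑ j, conj (c i) * c j *
      ((coef n : ℂ) * (t (x i) * conj (t (x j))) ^ n * N (x i) (x j)))
      (∑ i, ∑ j, conj (c i) * c j * (K (x i) (x j) * N (x i) (x j))) :=
    hasSum_sum fun i _ => hasSum_sum fun j _ => ((hK _ _).mul_right _).mul_left _
  have h2 := h1.mapL Complex.reCLM
  convert! h2 using 1
  funext n
  rw [← form_real_mul]
  simp only [form, map_mul, map_pow, Complex.conj_conj, Complex.reCLM_apply]
  congr 1
  exact Finset.sum_congr rfl fun i _ => Finset.sum_congr rfl fun j _ => by ring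

theorem hasSum_form {coef : ℕ → ℝ} {t : X → ℂ} {K : X → X → ℂ}
    (hK : ∀ x y, HasSum (fun n => (coef n : ℂ) * (t x * conj (t y)) ^ n) (K x y))
    (x : ι → X) (c : ι → ℂ) :
    HasSum (fun n => coef n * ‖∑ i, c i * conj (t (x i)) ^ n‖ ^ 2) (form K x c) := by
  simpa [form_one] using hasSum_form_mul hK (fun _ _ => 1) x c

end Form

/-! ## Coefficients -/

/-- The Taylor coefficients of `(1 - t) ^ (-r)`. -/
def coeff (r : ℝ) (n : ℕ) : ℝ := Ring.choose (r + n - 1) n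

theorem coeff_zero (r : ℝ) : coeff r 0 = 1 := by simp [coeff]

theorem coeff_succ (r : ℝ) (n : ℕ) : coeff r (n + 1) = (r + n) / (n + 1) * coeff r n := by
  have key : ∀ n : ℕ, (n.factorial : ℝ) * coeff r n = (ascPochhammer ℝ n).eval r := by
    intro n
    have h := Ring.factorial_nsmul_multichoose_eq_ascPochhammer r n
    rw [Polynomial.ascPochhammer_smeval_eq_eval, Ring.multichoose_eq, nsmul_eq_mul] at h
    exact h
  have h1 := key (n + 1)
  rw [ascPochhammer_succ_right, Polynomial.eval_mul, ← key n, Nat.factorial_succ] at h1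
  have h2 : (n.factorial : ℝ) ≠ 0 := by positivity
  have h3 : (n + 1 : ℝ) ≠ 0 := by positivity
  simp only [Polynomial.eval_add, Polynomial.eval_X, Polynomial.eval_natCast] at h1
  push_cast at h1
  field_simp
  refine mul_left_cancel₀ h2 ?_
  linear_combination h1

theorem coeff_nonneg {r : ℝ} (hr : 0 ≤ r) (n : ℕ) : 0 ≤ coeff r n := by
  induction n with
  | zero => simp [coeff_zero]
  | succ n ih => rw [coeff_succ]; positivity

theorem coeff_succ_le {r : ℝ} (hr : 0 ≤ r) (hr1 : r ≤ 1) (n : ℕ) :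
    coeff r (n + 1) ≤ coeff r n := by
  rw [coeff_succ]
  refine mul_le_of_le_one_left (coeff_nonneg hr n) ?_
  rw [div_le_one (by positivity)]
  linarith

/-- The coefficient of index one is `-r`, and each later ratio `(n + 1 - r) / (n + 2)` is
non-negative because `r ≤ 1`. This is the source of the complete Pick property. -/
theorem coeff_neg_succ_nonpos {r : ℝ} (hr : 0 ≤ r) (hr1 : r ≤ 1) (n : ℕ) :
    coeff (-r) (n + 1) ≤ 0 := by
  induction n with
  | zero => simp [coeff_succ, coeff_zero, hr]
  | succ n ih =>
    rw [coeff_succ]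
    refine mul_nonpos_of_nonneg_of_nonpos (div_nonneg ?_ (by positivity)) ih
    push_cast
    have : (0 : ℝ) ≤ n := by positivity
    linarith

theorem hasSum_coeff (r : ℝ) {z : ℂ} (hz : ‖z‖ < 1) :
    HasSum (fun n : ℕ => (coeff r n : ℂ) * z ^ n) (1 / (1 - z) ^ (r : ℂ)) := by
  have h := (Complex.one_div_one_sub_cpow_hasFPowerSeriesOnBall_zero (r : ℂ)).hasSum
    (y := z) (by
      rw [← ENNReal.ofReal_one, Metric.eball_ofReal]
      simpa using hz)
  convert! h using 1
  · funext n
    simp [FormalMultilinearSeries.ofScalars, Complex.ofReal_choose, coeff]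
  · simp

/-! ## Kernel functions and the complete Pick property -/

theorem norm_mul_conj_lt_one (x y : 𝔻) : ‖(x : ℂ) * conj (y : ℂ)‖ < 1 := by
  rw [norm_mul, RCLike.norm_conj]
  exact mul_lt_one_of_nonneg_of_lt_one_left (norm_nonneg _) x.norm_lt_one y.norm_lt_one.le

theorem one_sub_mul_conj_ne_zero (x y : 𝔻) : 1 - (x : ℂ) * conj (y : ℂ) ≠ 0 := by
  intro h
  have := norm_mul_conj_lt_one x y
  rw [← sub_eq_zero.1 h] at this
  simp at this

variable {a : ℝ≥0}

/-- The kernel function of the Dirichlet space at `x`. -/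
def kap (a : ℝ≥0) (x : 𝔻) : DirichletSpace a := kerFun (DirichletSpace a) x 1

theorem inner_kap (x : 𝔻) (f : DirichletSpace a) : inner ℂ (kap a x) f = f x := by
  simp [kap]

theorem kap_apply (x y : 𝔻) : kap a y x = dirichletKernel a x y := by
  rw [kap, kerFun_apply, OfKernel.kernel_ofKernel]
  simp [dirichletKernelOp]

theorem inner_kap_kap (x y : 𝔻) : inner ℂ (kap a x) (kap a y) = dirichletKernel a x y := by
  rw [inner_kap, kap_apply]

theorem dirichletKernel_zero_right (x : 𝔻) : dirichletKernel a x 0 = 1 := by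
  simp [dirichletKernel]

theorem dirichletKernel_zero_left (x : 𝔻) : dirichletKernel a 0 x = 1 := by
  simp [dirichletKernel]

theorem form_dirichletKernel {ι : Type*} [Fintype ι] (x : ι → 𝔻) (c : ι → ℂ) :
    form (dirichletKernel a) x c = ‖∑ i, c i • kap a (x i)‖ ^ 2 := by
  rw [← form_inner]
  simp only [inner_kap_kap]

theorem hasSum_coeff_dirichletKernel (x y : 𝔻) :
    HasSum (fun n => (coeff a n : ℂ) * ((x : ℂ) * conj (y : ℂ)) ^ n) (dirichletKernel a x y) :=
  hasSum_coeff a (norm_mul_conj_lt_one x y)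

/-- The kernel `1 - 1 / k_a`. -/
def pickKernel (a : ℝ≥0) (x y : 𝔻) : ℂ := 1 - (1 - (x : ℂ) * conj (y : ℂ)) ^ ((a : ℝ) : ℂ)

/-- The Taylor coefficients of `1 - (1 - t) ^ a`. -/
def pickCoeff (a : ℝ≥0) (n : ℕ) : ℝ := if n = 0 then 0 else -coeff (-a) n

theorem pickCoeff_nonneg (ha1 : a ≤ 1) (n : ℕ) : 0 ≤ pickCoeff a n := by
  cases n with
  | zero => simp [pickCoeff]
  | succ n => simpa [pickCoeff] using coeff_neg_succ_nonpos a.2 (by exact_mod_cast ha1) n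

theorem pickCoeff_one : pickCoeff a 1 = a := by
  have := coeff_succ (-a : ℝ) 0
  simp only [zero_add, Nat.cast_zero, add_zero, div_one, coeff_zero, mul_one] at this
  simp [pickCoeff, this]

theorem hasSum_pickKernel (x y : 𝔻) :
    HasSum (fun n => (pickCoeff a n : ℂ) * ((x : ℂ) * conj (y : ℂ)) ^ n) (pickKernel a x y) := by
  have h := (hasSum_coeff (-a) (norm_mul_conj_lt_one x y)).neg
  have h2 := (hasSum_ite_eq (0 : ℕ) (1 : ℂ)).add h
  convert! h2 using 1
  · funext n
    rcases eq_or_ne n 0 with rfl | hn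
    · simp [pickCoeff, coeff_zero]
    · simp [pickCoeff, hn]
  · rw [pickKernel, Complex.ofReal_neg, Complex.cpow_neg]
    simp [sub_eq_add_neg]

theorem pickKernel_mul (x y : 𝔻) :
    pickKernel a x y * dirichletKernel a x y = dirichletKernel a x y - 1 := by
  have h : (1 - (x : ℂ) * conj (y : ℂ)) ^ ((a : ℝ) : ℂ) ≠ 0 := by
    simp [Complex.cpow_eq_zero_iff, one_sub_mul_conj_ne_zero]
  rw [pickKernel, dirichletKernel]
  field_simp

/-- By `pickKernel_mul` the full series sums to the form of `k_a - 1`, that is, to the right-hand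
side minus `‖∑ c i‖ ^ 2`; its terms are non-negative. -/
theorem sum_pickCoeff_mul_le (ha1 : a ≤ 1) {ι : Type*} [Fintype ι] (x : ι → 𝔻) (c : ι → ℂ)
    (s : Finset ℕ) :
    ∑ n ∈ s, pickCoeff a n * ‖∑ i, (c i * conj (x i : ℂ) ^ n) • kap a (x i)‖ ^ 2 ≤
      ‖∑ i, c i • kap a (x i)‖ ^ 2 := by
  have h := hasSum_form_mul (hasSum_pickKernel (a := a)) (dirichletKernel a) x c
  simp only [pickKernel_mul, form_sub, form_one, form_dirichletKernel] at h
  refine (sum_le_hasSum s (fun n _ => mul_nonneg (pickCoeff_nonneg ha1 n) (by positivity)) h).trans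
    (sub_le_self _ (by positivity))

/-- Multiplication by the coordinate maps the Dirichlet space to itself. -/
theorem exists_coord_mul (ha0 : 0 < a) (ha1 : a ≤ 1) (f : DirichletSpace a) :
    ∃ g : DirichletSpace a, ∀ x : 𝔻, g x = x * f x := by
  have hs : (Real.sqrt a : ℂ) ≠ 0 := by
    simpa [Real.sqrt_eq_zero] using ha0.ne'
  obtain ⟨g, hg, -⟩ := exists_inner_eq_of_norm_sum_le
    (Φ := fun x : 𝔻 => ((Real.sqrt a : ℂ) * conj (x : ℂ)) • kap a x) (Ψ := kap a) (by
      intro ι _ x c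
      -- The single term `n = 1`, with coefficient `a`, shows that multiplication by `√a z` is a
      -- contraction.
      have h := sum_pickCoeff_mul_le ha1 x c {1}
      have h2 : ∑ i, c i • ((Real.sqrt a : ℂ) * conj (x i : ℂ)) • kap a (x i) =
          (Real.sqrt a : ℂ) • ∑ i, (c i * conj (x i : ℂ) ^ 1) • kap a (x i) := by
        rw [Finset.smul_sum]
        refine Finset.sum_congr rfl fun i _ => ?_
        rw [smul_smul, smul_smul]
        congr 1
        ring
      rw [h2, norm_smul, mul_pow]
      simpa [pickCoeff_one] using h) f
  refine ⟨(Real.sqrt a : ℂ)⁻¹ • g, fun x => ?_⟩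
  have := hg x
  rw [inner_kap, inner_smul_left, inner_kap] at this
  simp [this, hs, mul_assoc]

/-- The shifts form a row contraction on the Dirichlet space. -/
theorem exists_sum_pickCoeff_mul (ha1 : a ≤ 1) (N : ℕ) (m : Fin N → DirichletSpace a) :
    ∃ f : DirichletSpace a,
      (∀ x : 𝔻, f x = ∑ n : Fin N, (Real.sqrt (pickCoeff a n) : ℂ) * (x : ℂ) ^ (n : ℕ) * m n x) ∧
      ‖f‖ ^ 2 ≤ ∑ n, ‖m n‖ ^ 2 := by
  obtain ⟨f, hf, hn⟩ := exists_inner_eq_of_norm_sum_le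
    (E := PiLp 2 fun _ : Fin N => DirichletSpace a)
    (Φ := fun x : 𝔻 => WithLp.toLp 2 fun n : Fin N =>
      ((Real.sqrt (pickCoeff a n) : ℂ) * conj (x : ℂ) ^ (n : ℕ)) • kap a x) (Ψ := kap a) (by
      intro ι _ x c
      have h := sum_pickCoeff_mul_le ha1 x c (Finset.range N)
      rw [Finset.sum_range] at h
      refine le_of_eq_of_le ?_ h
      rw [PiLp.norm_sq_eq_of_L2]
      refine Finset.sum_congr rfl fun n _ => ?_
      have h2 : (∑ i, c i • (WithLp.toLp 2 fun n : Fin N =>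
          ((Real.sqrt (pickCoeff a n) : ℂ) * conj (x i : ℂ) ^ (n : ℕ)) • kap a (x i) :
            PiLp 2 fun _ : Fin N => DirichletSpace a)) n =
          (Real.sqrt (pickCoeff a n) : ℂ) •
            ∑ i, (c i * conj (x i : ℂ) ^ (n : ℕ)) • kap a (x i) := by
        rw [WithLp.ofLp_sum, Finset.sum_apply, Finset.smul_sum]
        refine Finset.sum_congr rfl fun i _ => ?_
        rw [PiLp.smul_apply, smul_smul, smul_smul]
        congr 1
        ring
      rw [h2, norm_smul, mul_pow]
      simp [Real.sq_sqrt (pickCoeff_nonneg ha1 n)]) (WithLp.toLp 2 m)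
  refine ⟨f, fun x => ?_, ?_⟩
  · rw [← inner_kap, hf, PiLp.inner_apply]
    refine Finset.sum_congr rfl fun n _ => ?_
    rw [inner_smul_left, inner_kap]
    simp
  · rw [← sq_le_sq₀ (norm_nonneg _) (norm_nonneg _), PiLp.norm_sq_eq_of_L2] at hn
    exact hn

/-- A zero at the origin can be divided out without increasing the norm. -/
theorem exists_eq_coord_mul (ha1 : a ≤ 1) {f : DirichletSpace a} (hf : f 0 = 0) :
    ∃ g : DirichletSpace a, (∀ x : 𝔻, f x = x * g x) ∧ ‖g‖ ≤ ‖f‖ := by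
  obtain ⟨g, hg, hn⟩ := exists_inner_eq_of_norm_sum_le
    (Φ := fun x : {x : 𝔻 // x ≠ 0} => (conj (x : ℂ))⁻¹ • (kap a x - kap a 0))
    (Ψ := fun x : {x : 𝔻 // x ≠ 0} => kap a x) (by
      intro ι _ x c
      have h1 := hasSum_form (ι := ι) (t := fun x : {x : 𝔻 // x ≠ 0} => (x : ℂ))
        (fun x y => hasSum_coeff_dirichletKernel (a := a) x y) x c
      -- The Gram kernel of `Φ` is `(k_a - 1) / (x ȳ)`, whose coefficients are those of `k_a`
      -- shifted by one. They are dominated because the coefficients of `k_a` decrease.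
      have h2 := hasSum_form (ι := ι) (t := fun x : {x : 𝔻 // x ≠ 0} => (x : ℂ))
        (coef := fun n => coeff a (n + 1))
        (K := fun x y : {x : 𝔻 // x ≠ 0} =>
          inner ℂ ((conj (x : ℂ))⁻¹ • (kap a x - kap a 0)) ((conj (y : ℂ))⁻¹ • (kap a y - kap a 0)))
        (by
          intro x y
          have hx : (x : ℂ) ≠ 0 := by simpa using x.2
          have hy : conj (y : ℂ) ≠ 0 := by simpa using y.2
          have h := (hasSum_nat_add_iff' 1).2 (hasSum_coeff_dirichletKernel (a := a) x y)
          have h' := h.mul_left ((x : ℂ)⁻¹ * (conj (y : ℂ))⁻¹)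
          convert! h' using 1
          · funext n
            rw [pow_succ]
            field_simp
          · rw [inner_smul_left, inner_smul_right, inner_sub_left, inner_sub_right, inner_sub_right,
              inner_kap_kap, inner_kap_kap, inner_kap_kap, inner_kap_kap]
            simp [dirichletKernel_zero_left, dirichletKernel_zero_right, coeff_zero]
            ring) x c
      rw [form_inner] at h2
      have h3 : form (fun x y : {x : 𝔻 // x ≠ 0} => dirichletKernel a x y) x c =
          ‖∑ i, c i • kap a (x i)‖ ^ 2 := form_dirichletKernel (fun i => (x i : 𝔻)) c
      rw [h3] at h1
      exact hasSum_le (fun n => mul_le_mul_of_nonneg_right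
        (coeff_succ_le a.2 (by exact_mod_cast ha1) n) (by positivity)) h2 h1) f
  refine ⟨g, fun x => ?_, hn⟩
  rcases eq_or_ne x 0 with rfl | hx
  · simp [hf]
  · have h := hg ⟨x, hx⟩
    have hx' : (x : ℂ) ≠ 0 := by simpa using hx
    rw [inner_kap, inner_smul_left, inner_sub_left, inner_kap, inner_kap, hf] at h
    simp only [sub_zero, map_inv₀, Complex.conj_conj] at h
    rw [h]
    field_simp

/-! ## Contractive multipliers -/

/-- Positivity of the kernel `(1 - φ(x) conj φ(y)) k_a(x, y)`. -/
def IsContractive (a : ℝ≥0) (φ : 𝔻 → ℂ) : Prop :=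
  ∀ (ι : Type) [Fintype ι] (x : ι → 𝔻) (c : ι → ℂ),
    0 ≤ form (fun x y => (1 - φ x * conj (φ y)) * dirichletKernel a x y) x c

theorem IsContractive.exists_mul {φ : 𝔻 → ℂ} (hφ : IsContractive a φ) (f : DirichletSpace a) :
    ∃ g : DirichletSpace a, (∀ x, g x = φ x * f x) ∧ ‖g‖ ≤ ‖f‖ := by
  obtain ⟨g, hg, hn⟩ := exists_inner_eq_of_norm_sum_le
    (Φ := fun x : 𝔻 => conj (φ x) • kap a x) (Ψ := kap a) (by
      intro ι _ x c
      have h := hφ ι x c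
      simp only [sub_mul, one_mul, form_sub, form_conj_mul, form_dirichletKernel] at h
      simpa [smul_smul] using h) f
  refine ⟨g, fun x => ?_, hn⟩
  rw [← inner_kap, hg, inner_smul_left, inner_kap]
  simp

theorem IsContractive.isMultiplier {φ : 𝔻 → ℂ} (hφ : IsContractive a φ) :
    IsMultiplier (DirichletSpace a) φ := fun f =>
  let ⟨g, hg, _⟩ := hφ.exists_mul f
  ⟨g, hg⟩

theorem IsContractive.multiplierNorm_le {φ : 𝔻 → ℂ} (hφ : IsContractive a φ) :
    multiplierNorm (DirichletSpace a) φ ≤ 1 := by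
  refine sSup_le ?_
  rintro r ⟨f, g, hf, hg, rfl⟩
  obtain ⟨g', hg', hn⟩ := hφ.exists_mul f
  obtain rfl : g = g' := RKHS.ext fun x => by rw [hg, hg']
  rw [← ofReal_norm, ENNReal.ofReal_le_one]
  exact hn.trans hf

/-! ## Spaces of functions vanishing on a set -/

/-- The space of functions in the Dirichlet space that vanish on `Z`. -/
def vanishing (a : ℝ≥0) (Z : Set 𝔻) : Submodule ℂ (DirichletSpace a) where
  carrier := {f | ∀ z ∈ Z, f z = 0}
  add_mem' hf hg z hz := by simp [hf z hz, hg z hz]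
  zero_mem' z _ := by simp
  smul_mem' c f hf z hz := by simp [hf z hz]

theorem mem_vanishing {Z : Set 𝔻} {f : DirichletSpace a} :
    f ∈ vanishing a Z ↔ ∀ z ∈ Z, f z = 0 := Iff.rfl

theorem isClosed_vanishing (Z : Set 𝔻) : IsClosed (vanishing a Z : Set (DirichletSpace a)) := by
  have : (vanishing a Z : Set (DirichletSpace a)) = ⋂ z ∈ Z, {f | f z = 0} := by
    ext f
    simp [mem_vanishing]
  rw [this]
  exact isClosed_biInter fun z _ => isClosed_eq (continuous_eval z) continuous_const

instance (Z : Set 𝔻) : CompleteSpace (vanishing a Z) :=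
  (isClosed_vanishing Z).completeSpace_coe

/-- The kernel function at `w` of the space of functions vanishing on `Z`. -/
def extremal (a : ℝ≥0) (Z : Set 𝔻) (w : 𝔻) : DirichletSpace a :=
  (vanishing a Z).starProjection (kap a w)

variable {Z : Set 𝔻} {w : 𝔻}

theorem extremal_mem : extremal a Z w ∈ vanishing a Z :=
  Submodule.starProjection_apply_mem _ _

theorem inner_extremal {f : DirichletSpace a} (hf : f ∈ vanishing a Z) :
    inner ℂ (extremal a Z w) f = f w := by
  rw [extremal, Submodule.inner_starProjection_left_eq_right,
    Submodule.starProjection_eq_self_iff.2 hf, inner_kap]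

theorem extremal_apply_self : extremal a Z w w = (‖extremal a Z w‖ : ℂ) ^ 2 := by
  rw [← inner_extremal extremal_mem, inner_self_eq_norm_sq_to_K]
  simp

theorem norm_sum_extremal_le {ι : Type*} [Fintype ι] (x : ι → 𝔻) (c : ι → ℂ) :
    ‖∑ i, c i • extremal a Z (x i)‖ ≤ ‖∑ i, c i • kap a (x i)‖ := by
  simp only [extremal, ← map_smul, ← map_sum]
  exact Submodule.norm_starProjection_apply_le _ _

/-- Since `f` is orthogonal to `e`, only the component of `u` orthogonal to `e` contributes to `⟪u,
f⟫`; apply Cauchy–Schwarz to it. -/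
theorem norm_inner_sq_mul_le_of_inner_eq_zero {E : Type*} [NormedAddCommGroup E]
    [InnerProductSpace ℂ E] {e f : E} (u : E) (h : inner ℂ e f = 0) (he : ‖e‖ = 1) :
    ‖inner ℂ u f‖ ^ 2 ≤ (‖u‖ ^ 2 - ‖inner ℂ e u‖ ^ 2) * ‖f‖ ^ 2 := by
  have h1 : inner ℂ (u - inner ℂ e u • e) f = inner ℂ u f := by
    simp [h]
  have h2 : ‖u - inner ℂ e u • e‖ ^ 2 = ‖u‖ ^ 2 - ‖inner ℂ e u‖ ^ 2 := by
    have h3 : inner ℂ (u - inner ℂ e u • e) (inner ℂ e u • e) = 0 := by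
      simp [inner_self_eq_norm_sq_to_K, he]
    have h4 := norm_add_sq_eq_norm_sq_add_norm_sq_of_inner_eq_zero _ _ h3
    rw [sub_add_cancel, norm_smul, he] at h4
    nlinarith
  rw [← h1, ← h2, ← mul_pow]
  exact pow_le_pow_left₀ (norm_nonneg _) (norm_inner_le_norm _ _) 2

/-- The row contraction of shifts maps functions vanishing on `Z` to functions orthogonal to the
extremal function at the origin. -/
theorem sum_pickCoeff_extremal_le (ha1 : a ≤ 1) (hF : extremal a Z 0 ≠ 0) {ι : Type*} [Fintype ι]
    (x : ι → 𝔻) (c : ι → ℂ) (N : ℕ) :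
    ∑ n ∈ Finset.range N, pickCoeff a n *
        ‖∑ i, (c i * conj (x i : ℂ) ^ n) • extremal a Z (x i)‖ ^ 2 ≤
      ‖∑ i, c i • extremal a Z (x i)‖ ^ 2 -
        ‖∑ i, c i * conj ((‖extremal a Z 0‖⁻¹ : ℝ) * extremal a Z 0 (x i))‖ ^ 2 := by
  set F := extremal a Z 0 with hFdef
  set e : DirichletSpace a := ((‖F‖⁻¹ : ℝ) : ℂ) • F with he
  have hFn : ‖F‖ ≠ 0 := norm_ne_zero_iff.2 hF
  have hen : ‖e‖ = 1 := by simp [he, norm_smul, hFn]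
  set u := ∑ i, c i • extremal a Z (x i) with hu
  -- `m` is the adjoint of the row contraction applied to `∑ c i • kap a (x i)`, projected to the
  -- vanishing subspace in each component. With this choice `⟪u, f⟫ = ∑ ‖m n‖ ^ 2` below.
  let m : Fin N → DirichletSpace a := fun n =>
    (Real.sqrt (pickCoeff a n) : ℂ) •
      ∑ i, (c i * conj (x i : ℂ) ^ (n : ℕ)) • extremal a Z (x i)
  have hm : ∀ n, m n ∈ vanishing a Z := fun n =>
    Submodule.smul_mem _ _ (Submodule.sum_mem _ fun i _ => Submodule.smul_mem _ _ extremal_mem)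
  have hmn : ∀ n, ‖m n‖ ^ 2 = pickCoeff a n *
        ‖∑ i, (c i * conj (x i : ℂ) ^ (n : ℕ)) • extremal a Z (x i)‖ ^ 2 := by
    intro n
    rw [norm_smul, mul_pow]
    simp [Real.sq_sqrt (pickCoeff_nonneg ha1 n)]
  obtain ⟨f, hf, hfn⟩ := exists_sum_pickCoeff_mul ha1 N m
  have hfM : f ∈ vanishing a Z := fun z hz => by
    rw [hf]
    exact Finset.sum_eq_zero fun n _ => by rw [hm n z hz, mul_zero]
  -- The term `n = 0` has coefficient zero and the others carry a power of `x`; hence `f` is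
  -- orthogonal to the extremal function at the origin.
  have hf0 : f 0 = 0 := by
    rw [hf]
    refine Finset.sum_eq_zero fun n _ => ?_
    rcases eq_or_ne (n : ℕ) 0 with hn | hn <;> simp [hn, pickCoeff]
  have hef : inner ℂ e f = 0 := by
    rw [he, inner_smul_left, inner_extremal hfM, hf0, mul_zero]
  have heM : e ∈ vanishing a Z := Submodule.smul_mem _ _ extremal_mem
  have heu : inner ℂ e u = ∑ i, c i * conj ((‖F‖⁻¹ : ℝ) * F (x i)) := by
    rw [hu, inner_sum]
    refine Finset.sum_congr rfl fun i _ => ?_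
    rw [inner_smul_right, ← inner_conj_symm, inner_extremal heM]
    simp [he]
  set S := ∑ n, ‖m n‖ ^ 2 with hS
  have huf : inner ℂ u f = (S : ℂ) := by
    have h1 : ∀ n, ((‖m n‖ ^ 2 : ℝ) : ℂ) =
        ∑ i, conj (c i) * ((Real.sqrt (pickCoeff a n) : ℂ) * (x i : ℂ) ^ (n : ℕ) * m n (x i)) := by
      intro n
      have h2 : ((‖m n‖ ^ 2 : ℝ) : ℂ) = inner ℂ (m n) (m n) := by
        rw [inner_self_eq_norm_sq_to_K]
        simp
      rw [h2]
      conv_lhs => enter [2]; simp only [m]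
      rw [inner_smul_left, sum_inner, Finset.mul_sum]
      refine Finset.sum_congr rfl fun i _ => ?_
      rw [inner_smul_left, inner_extremal (hm n)]
      simp
      ring
    rw [hS, Complex.ofReal_sum, Finset.sum_congr rfl fun n _ => h1 n, Finset.sum_comm, hu,
      sum_inner]
    refine Finset.sum_congr rfl fun i _ => ?_
    rw [inner_smul_left, inner_extremal hfM, hf, Finset.mul_sum]
  have key := norm_inner_sq_mul_le_of_inner_eq_zero u hef hen
  have hS0 : 0 ≤ S := Finset.sum_nonneg fun n _ => by positivity
  have hT0 : 0 ≤ ‖u‖ ^ 2 - ‖inner ℂ e u‖ ^ 2 := by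
    have := norm_inner_le_norm (𝕜 := ℂ) e u
    rw [hen, one_mul] at this
    nlinarith [norm_nonneg (inner ℂ e u)]
  -- With `T` the right-hand side, `S ^ 2 ≤ T * ‖f‖ ^ 2 ≤ T * S`; cancel `S` when it is positive.
  have hgoal : S ≤ ‖u‖ ^ 2 - ‖inner ℂ e u‖ ^ 2 := by
    rw [huf, Complex.norm_real, Real.norm_of_nonneg hS0] at key
    have h3 := key.trans (mul_le_mul_of_nonneg_left hfn hT0)
    rcases hS0.eq_or_lt with h | h
    · rwa [← h]
    · nlinarith
  rw [heu] at hgoal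
  rw [Finset.sum_range]
  simpa only [hS, hmn] using hgoal

/-- The normalized extremal function at the origin is a contractive multiplier. -/
theorem isContractive_extremal (ha1 : a ≤ 1) (hF : extremal a Z 0 ≠ 0) :
    IsContractive a fun x => ((‖extremal a Z 0‖⁻¹ : ℝ) : ℂ) * extremal a Z 0 x := by
  set φ : 𝔻 → ℂ := fun x => ((‖extremal a Z 0‖⁻¹ : ℝ) : ℂ) * extremal a Z 0 x with hφ
  let kM : 𝔻 → 𝔻 → ℂ := fun x y => inner ℂ (extremal a Z x) (extremal a Z y)
  have hφform : ∀ (ι : Type) [Fintype ι] (x : ι → 𝔻) (c : ι → ℂ),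
      form (fun x y => φ x * conj (φ y)) x c = ‖∑ i, c i * conj (φ (x i))‖ ^ 2 := by
    intro ι _ x c
    simpa [form_one] using form_conj_mul φ (fun _ _ => 1) x c
  have hN : ∀ (ι : Type) [Fintype ι] (x : ι → 𝔻) (c : ι → ℂ),
      0 ≤ form (fun x y => (kM x y - φ x * conj (φ y)) - pickKernel a x y * kM x y) x c := by
    intro ι _ x c
    rw [form_sub, form_sub, hφform, form_inner, sub_nonneg]
    refine le_of_tendsto (hasSum_form_mul hasSum_pickKernel kM x c).tendsto_sum_nat
      (Filter.Eventually.of_forall fun N => ?_)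
    simpa only [kM, form_inner] using sum_pickCoeff_extremal_le ha1 hF x c N
  intro ι _ x c
  -- Schur product with `k_a`: since `k_a (1 - pickKernel) = 1`, the positive kernel becomes `kM - φ
  -- φ̄ k_a`. It remains to use that `kM` is dominated by `k_a`, being the kernel of a subspace.
  have h := (hasSum_form_mul hasSum_coeff_dirichletKernel
    (fun x y => (kM x y - φ x * conj (φ y)) - pickKernel a x y * kM x y) x c).nonneg fun n =>
    mul_nonneg (coeff_nonneg a.2 n) (hN ι x _)
  have h2 : (fun x y => dirichletKernel a x y *
      ((kM x y - φ x * conj (φ y)) - pickKernel a x y * kM x y)) =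
      fun x y => kM x y - φ x * conj (φ y) * dirichletKernel a x y := by
    funext x y
    linear_combination -(kM x y) * pickKernel_mul (a := a) x y
  rw [h2, form_sub, form_inner] at h
  simp only [sub_mul, one_mul, form_sub, form_dirichletKernel]
  have := pow_le_pow_left₀ (norm_nonneg _) (norm_sum_extremal_le (a := a) (Z := Z) x c) 2
  linarith

/-! ## Conformal invariance -/

/-- The map `τ` satisfies the identity that characterizes the automorphisms of the disc sending `p`
to the origin. -/
def IsConformal (τ : 𝔻 → 𝔻) (p : 𝔻) : Prop :=
  ∀ x y : 𝔻, (1 - (x : ℂ) * conj (y : ℂ)) * (1 - (p : ℂ) * conj (p : ℂ)) =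
    (1 - (τ x : ℂ) * conj (τ y : ℂ)) * (1 - (x : ℂ) * conj (p : ℂ)) * (1 - (p : ℂ) * conj (y : ℂ))

theorem abs_arg_one_sub_lt (x y : 𝔻) : |arg (1 - (x : ℂ) * conj (y : ℂ))| < Real.pi / 2 := by
  rw [Complex.abs_arg_lt_pi_div_two_iff]
  left
  have := (Complex.re_le_norm _).trans_lt (norm_mul_conj_lt_one x y)
  simpa using this

/-- This is the defining identity raised to the power `-a`. The principal logarithms add without a
multiple of `2πi`: four arguments are less than `π / 2` in absolute value and that of `1 - |p|²` is
zero, so the discrepancy is below `2π`. -/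
theorem IsConformal.dirichletKernel_mul {τ : 𝔻 → 𝔻} {p : 𝔻} (h : IsConformal τ p) (x y : 𝔻) :
    dirichletKernel a (τ x) (τ y) * dirichletKernel a x p * dirichletKernel a p y =
      dirichletKernel a x y * dirichletKernel a p p := by
  have hlog : log (1 - (x : ℂ) * conj (y : ℂ)) + log (1 - (p : ℂ) * conj (p : ℂ)) =
      log (1 - (τ x : ℂ) * conj (τ y : ℂ)) + log (1 - (x : ℂ) * conj (p : ℂ)) +
        log (1 - (p : ℂ) * conj (y : ℂ)) := by
    have hexp := h x y
    rw [← exp_log (one_sub_mul_conj_ne_zero x y), ← exp_log (one_sub_mul_conj_ne_zero p p),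
      ← exp_log (one_sub_mul_conj_ne_zero (τ x) (τ y)), ← exp_log (one_sub_mul_conj_ne_zero x p),
      ← exp_log (one_sub_mul_conj_ne_zero p y), ← exp_add, ← exp_add, ← exp_add,
      exp_eq_exp_iff_exists_int] at hexp
    obtain ⟨n, hn⟩ := hexp
    have him := congrArg Complex.im hn
    have hp : arg (1 - (p : ℂ) * conj (p : ℂ)) = 0 := by
      rw [Complex.mul_conj, ← Complex.ofReal_one, ← Complex.ofReal_sub]
      exact arg_ofReal_of_nonneg (sub_nonneg.2 p.normSq_lt_one.le)
    simp only [add_im, log_im, hp, mul_im, mul_re, intCast_re, intCast_im] at him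
    have h1 := abs_lt.1 (abs_arg_one_sub_lt x y)
    have h2 := abs_lt.1 (abs_arg_one_sub_lt (τ x) (τ y))
    have h3 := abs_lt.1 (abs_arg_one_sub_lt x p)
    have h4 := abs_lt.1 (abs_arg_one_sub_lt p y)
    simp at him
    have hpi := Real.pi_pos
    have hn1 : (n : ℝ) < 1 := by
      by_contra! hc
      nlinarith
    have hn2 : (-1 : ℝ) < n := by
      by_contra! hc
      nlinarith
    have hn0 : n = 0 := by
      have hn1' : n < 1 := by exact_mod_cast hn1
      have hn2' : -1 < n := by exact_mod_cast hn2
      omega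
    rw [hn, hn0]
    simp
  simp only [dirichletKernel, cpow_def_of_ne_zero (one_sub_mul_conj_ne_zero _ _), one_div,
    ← exp_neg, ← exp_add]
  congr 1
  linear_combination (a : ℂ) * hlog

theorem conj_dirichletKernel (x y : 𝔻) :
    conj (dirichletKernel a x y) = dirichletKernel a y x := by
  rw [← inner_kap_kap, inner_conj_symm, inner_kap_kap]

theorem dirichletKernel_self (x : 𝔻) : dirichletKernel a x x = (‖kap a x‖ : ℂ) ^ 2 := by
  rw [← inner_kap_kap, inner_self_eq_norm_sq_to_K]
  simp

theorem dirichletKernel_ne_zero (x y : 𝔻) : dirichletKernel a x y ≠ 0 := by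
  simp [dirichletKernel, Complex.cpow_eq_zero_iff, one_sub_mul_conj_ne_zero]

theorem norm_kap_ne_zero (x : 𝔻) : (‖kap a x‖ : ℂ) ≠ 0 := by
  intro h
  have := dirichletKernel_self (a := a) x
  rw [h] at this
  exact dirichletKernel_ne_zero x x (by simpa using this)

/-- The normalized kernel function at `p`. -/
def weight (a : ℝ≥0) (p x : 𝔻) : ℂ := dirichletKernel a x p / ‖kap a p‖

theorem weight_ne_zero (p x : 𝔻) : weight a p x ≠ 0 :=
  div_ne_zero (dirichletKernel_ne_zero _ _) (norm_kap_ne_zero _)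

theorem IsConformal.weight_mul {τ : 𝔻 → 𝔻} {p : 𝔻} (h : IsConformal τ p) (x y : 𝔻) :
    weight a p x * conj (weight a p y) * dirichletKernel a (τ x) (τ y) =
      dirichletKernel a x y := by
  have h1 := h.dirichletKernel_mul (a := a) x y
  rw [dirichletKernel_self p] at h1
  have h2 := norm_kap_ne_zero (a := a) p
  rw [weight, weight, map_div₀, conj_dirichletKernel, Complex.conj_ofReal]
  field_simp
  linear_combination h1

/-- By `weight_mul` the weighted kernel functions at the points `τ x` have the same Gram matrix as
the kernel functions at `x`. -/
theorem IsConformal.exists_comp {τ : 𝔻 → 𝔻} {p : 𝔻} (h : IsConformal τ p)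
    (f : DirichletSpace a) :
    ∃ g : DirichletSpace a, (∀ x, g x = weight a p x * f (τ x)) ∧ ‖g‖ ≤ ‖f‖ := by
  obtain ⟨g, hg, hn⟩ := exists_inner_eq_of_norm_sum_le
    (Φ := fun x : 𝔻 => conj (weight a p x) • kap a (τ x)) (Ψ := kap a) (by
      intro ι _ x c
      rw [← form_inner (fun x => conj (weight a p x) • kap a (τ x)), ← form_inner (kap a)]
      simp only [inner_smul_left, inner_smul_right, inner_kap_kap, Complex.conj_conj,
        ← mul_assoc, mul_comm (conj _) (weight a p _), h.weight_mul, le_refl]) f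
  refine ⟨g, fun x => ?_, hn⟩
  rw [← inner_kap, hg, inner_smul_left, inner_kap]
  simp

/-- The form for `φ ∘ τ` is the form for `φ` at the points `τ (x i)`, with coefficients rescaled by
the weight. -/
theorem IsContractive.comp {φ : 𝔻 → ℂ} (hφ : IsContractive a φ) {τ : 𝔻 → 𝔻} {p : 𝔻}
    (h : IsConformal τ p) : IsContractive a (φ ∘ τ) := by
  intro ι _ x c
  have h1 := hφ ι (τ ∘ x) fun i => c i * conj (weight a p (x i))
  have h2 := form_conj_mul (weight a p)
    (fun x y => (1 - φ (τ x) * conj (φ (τ y))) * dirichletKernel a (τ x) (τ y)) x c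
  refine h1.trans_eq (h2.symm.trans ?_)
  congr 1
  funext x y
  rw [← h.weight_mul x y]
  simp only [Function.comp_apply]
  ring

/-! ## Automorphisms of the disc -/

theorem one_sub_moebius (p x : 𝔻) (y : 𝔻) :
    (1 - (x : ℂ) * conj (y : ℂ)) * (1 - (p : ℂ) * conj (p : ℂ)) =
      (1 - (p - x : ℂ) / (1 - x * conj (p : ℂ)) * conj ((p - y : ℂ) / (1 - y * conj (p : ℂ)))) *
        (1 - (x : ℂ) * conj (p : ℂ)) * (1 - (p : ℂ) * conj (y : ℂ)) := by
  have h1 := one_sub_mul_conj_ne_zero x p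
  have h2 := one_sub_mul_conj_ne_zero p y
  simp only [map_div₀, map_sub, map_mul, map_one, Complex.conj_conj]
  rw [mul_comm (p : ℂ) (conj (y : ℂ))] at h2 ⊢
  field_simp
  ring

theorem norm_moebius_lt_one (p x : 𝔻) : ‖(p - x : ℂ) / (1 - x * conj (p : ℂ))‖ < 1 := by
  have h := one_sub_moebius p x x
  rw [Complex.mul_conj, Complex.mul_conj, Complex.mul_conj, mul_assoc,
    show (1 - (p : ℂ) * conj (x : ℂ)) = conj (1 - (x : ℂ) * conj (p : ℂ)) by simp [mul_comm],
    Complex.mul_conj, Complex.normSq_eq_norm_sq ((p - x : ℂ) / _)] at h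
  norm_cast at h
  have h1 := mul_pos (sub_pos.2 x.normSq_lt_one) (sub_pos.2 p.normSq_lt_one)
  rw [h] at h1
  have h2 := pos_of_mul_pos_left h1 (Complex.normSq_nonneg _)
  nlinarith [norm_nonneg ((p - x : ℂ) / (1 - x * conj (p : ℂ)))]

/-- The involutive automorphism of the disc that exchanges `p` and the origin. -/
def moebius (p x : 𝔻) : 𝔻 :=
  UnitDisc.mk ((p - x : ℂ) / (1 - x * conj (p : ℂ))) (norm_moebius_lt_one p x)

theorem coe_moebius (p x : 𝔻) : (moebius p x : ℂ) = (p - x : ℂ) / (1 - x * conj (p : ℂ)) := rfl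

theorem isConformal_moebius (p : 𝔻) : IsConformal (moebius p) p := one_sub_moebius p

theorem moebius_zero (p : 𝔻) : moebius p 0 = p := by
  rw [← UnitDisc.coe_inj, coe_moebius]
  simp

theorem moebius_self (p : 𝔻) : moebius p p = 0 := by
  rw [← UnitDisc.coe_inj, coe_moebius]
  simp

theorem moebius_moebius (p x : 𝔻) : moebius p (moebius p x) = x := by
  have h1 := one_sub_mul_conj_ne_zero x p
  have h2 := one_sub_mul_conj_ne_zero (moebius p x) p
  have h3 := one_sub_mul_conj_ne_zero p p
  rw [← UnitDisc.coe_inj, coe_moebius, div_eq_iff h2, coe_moebius]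
  field_simp
  ring

theorem coe_moebius_eq_zero {p x : 𝔻} : (moebius p x : ℂ) = 0 ↔ x = p := by
  constructor
  · intro h
    rw [UnitDisc.coe_eq_zero] at h
    rw [← moebius_moebius p x, h, moebius_zero]
  · rintro rfl
    rw [moebius_self, UnitDisc.coe_zero]

/-- A zero at `p` can be divided out without increasing the norm. -/
theorem exists_eq_moebius_mul (ha1 : a ≤ 1) {p : 𝔻} {f : DirichletSpace a} (hf : f p = 0) :
    ∃ g : DirichletSpace a, (∀ x : 𝔻, f x = moebius p x * g x) ∧ ‖g‖ ≤ ‖f‖ := by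
  obtain ⟨f₁, hf₁, hn₁⟩ := (isConformal_moebius p).exists_comp f
  obtain ⟨g₁, hg₁, hn₂⟩ := exists_eq_coord_mul ha1 (f := f₁) (by rw [hf₁, moebius_zero, hf, mul_zero])
  obtain ⟨g, hg, hn₃⟩ := (isConformal_moebius p).exists_comp g₁
  refine ⟨g, fun x => ?_, hn₃.trans (hn₂.trans hn₁)⟩
  -- The weighted composition operator with `moebius p` is an involution, so transporting there and
  -- back leaves no weight.
  have hw : weight a p x * weight a p (moebius p x) = 1 := by
    have h := (isConformal_moebius p).dirichletKernel_mul (a := a) x 0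
    rw [moebius_zero, dirichletKernel_zero_right, dirichletKernel_zero_right,
      dirichletKernel_self p] at h
    have h2 := norm_kap_ne_zero (a := a) p
    rw [weight, weight]
    field_simp
    linear_combination h
  have h1 := hf₁ (moebius p x)
  rw [hg₁, moebius_moebius] at h1
  rw [hg]
  linear_combination (-(f x)) * hw - weight a p x * h1

/-- An automorphism of the disc fixing the origin is a rotation. -/
theorem exists_eq_mul_of_map_zero {η ζ : 𝔻 → 𝔻} (hη : IsHolomorphic η) (hζ : IsHolomorphic ζ)
    (h : ∀ x, ζ (η x) = x) (h0 : η 0 = 0) :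
    ∃ C : ℂ, ‖C‖ = 1 ∧ ∀ x : 𝔻, (η x : ℂ) = C * x := by
  have schwarz : ∀ {η : 𝔻 → 𝔻} {F : ℂ → ℂ}, DifferentiableOn ℂ F (Metric.ball 0 1) →
      (∀ z : 𝔻, F z = η z) → η 0 = 0 →
      MapsTo F (Metric.ball 0 1) (Metric.closedBall 0 1) ∧ F 0 = 0 ∧
        ∀ x : 𝔻, ‖(η x : ℂ)‖ ≤ ‖(x : ℂ)‖ := by
    intro η F hF hFη h0
    have hm : MapsTo F (Metric.ball 0 1) (Metric.closedBall 0 1) := by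
      intro z hz
      have := hFη (UnitDisc.mk z (by simpa using hz))
      rw [UnitDisc.coe_mk] at this
      rw [this]
      simpa using (UnitDisc.norm_lt_one _).le
    have hF0 : F 0 = 0 := by simpa [h0] using hFη 0
    exact ⟨hm, hF0, fun x => hFη x ▸ norm_le_norm_of_mapsTo_ball hF hm hF0 x.norm_lt_one⟩
  obtain ⟨F, hF, hFη⟩ := hη
  obtain ⟨G, hG, hGζ⟩ := hζ
  obtain ⟨hm, hF0, hle⟩ := schwarz hF hFη h0
  obtain ⟨-, -, hle'⟩ := schwarz hG hGζ (by simpa [h0] using h 0)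
  have hnorm : ∀ x : 𝔻, ‖(η x : ℂ)‖ = ‖(x : ℂ)‖ := fun x =>
    (hle x).antisymm (by simpa [h] using hle' (η x))
  have hhalf : ‖(1 / 2 : ℂ)‖ < 1 := by norm_num
  -- The Schwarz lemma for both `η` and `ζ` gives `‖η x‖ = ‖x‖`. The equality case is invoked at `1
  -- / 2`, though any non-zero point would serve.
  obtain ⟨C, hC, hCF⟩ := affine_of_mapsTo_ball_of_exists_norm_dslope_eq_div' (R₂ := 1) hF
    (by rwa [hF0]) ⟨1 / 2, by simpa using hhalf, by
      rw [dslope_of_ne _ (by norm_num), slope_def_field, hF0, norm_div, sub_zero, sub_zero]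
      have h1 := hFη (UnitDisc.mk (1 / 2) hhalf)
      have h2 := hnorm (UnitDisc.mk (1 / 2) hhalf)
      rw [← h1, UnitDisc.coe_mk] at h2
      rw [h2]
      norm_num⟩
  refine ⟨C, by simpa using hC, fun x => ?_⟩
  rw [← hFη, hCF (by simpa using x.norm_lt_one), hF0]
  simp [mul_comm]

theorem isHolomorphic_moebius (p : 𝔻) : IsHolomorphic (moebius p) := by
  refine ⟨fun z => (p - z) / (1 - z * conj (p : ℂ)), ?_, fun z => rfl⟩
  refine DifferentiableOn.div (by fun_prop) (by fun_prop) fun z hz => ?_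
  have := one_sub_mul_conj_ne_zero (UnitDisc.mk z (by simpa using hz)) p
  simpa using this

/-- The map `θ ∘ moebius p` fixes the origin, hence is a rotation, and the unimodular constant
cancels in the identity for `moebius p`. -/
theorem isConformal_discAut (θ : discAut) : IsConformal (θ : 𝔻 ≃ₜ 𝔻) ((θ : 𝔻 ≃ₜ 𝔻).symm 0) := by
  set p := (θ : 𝔻 ≃ₜ 𝔻).symm 0 with hp
  have hθp : (θ : 𝔻 ≃ₜ 𝔻) p = 0 := by simp [hp]
  obtain ⟨C, hC, h⟩ := exists_eq_mul_of_map_zero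
    (θ.2.1.comp (isHolomorphic_moebius p)) ((isHolomorphic_moebius p).comp θ.2.2)
    (fun x => by simp [moebius_moebius]) (by simp [moebius_zero, hθp])
  have h' : ∀ x, ((θ : 𝔻 ≃ₜ 𝔻) x : ℂ) = C * moebius p x := fun x => by
    simpa [moebius_moebius] using h (moebius p x)
  intro x y
  have hCC : C * conj C = 1 := by rw [Complex.mul_conj']; simp [hC]
  rw [isConformal_moebius p x y, h', h', map_mul]
  linear_combination (moebius p x * conj (moebius p y : ℂ)) * (1 - (x : ℂ) * conj (p : ℂ)) *
    (1 - (p : ℂ) * conj (y : ℂ)) * hCC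

/-! ## Zero sets -/

theorem norm_apply_le_kap (f : DirichletSpace a) (x : 𝔻) : ‖f x‖ ≤ ‖kap a x‖ * ‖f‖ := by
  rw [← inner_kap]
  exact norm_inner_le_norm _ _

/-- A function in the Dirichlet space cannot be supported at a single point. -/
theorem exists_ne_apply_ne_zero (ha1 : a ≤ 1) {g : DirichletSpace a} {w : 𝔻} (hg : g w ≠ 0) :
    ∃ v, v ≠ w ∧ g v ≠ 0 := by
  by_contra! H
  -- If every `v ≠ w` is a zero, dividing it out bounds `‖g w‖` by a multiple of `‖moebius v w‖`,
  -- which tends to zero as `v` tends to `w`.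
  have hb : ∀ v, v ≠ w → ‖g w‖ ≤ ‖(moebius v w : ℂ)‖ * (‖kap a w‖ * ‖g‖) := by
    intro v hv
    obtain ⟨h, hh, hn⟩ := exists_eq_moebius_mul ha1 (H v hv)
    rw [hh, norm_mul]
    gcongr
    exact (norm_apply_le_kap h w).trans (by gcongr)
  have hc : ContinuousAt (fun t : ℂ => ‖(t - w) / (1 - w * conj t)‖ * (‖kap a w‖ * ‖g‖)) w := by
    have h1 : ContinuousAt (fun t : ℂ => 1 - w * conj t) w :=
      (continuous_const.sub (continuous_const.mul Complex.continuous_conj)).continuousAt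
    have h2 : ContinuousAt (fun t : ℂ => t - w) w := by fun_prop
    exact (h2.div h1 (one_sub_mul_conj_ne_zero w w)).norm.mul_const _
  have hlt : ∀ᶠ t : ℂ in nhdsWithin (w : ℂ) {(w : ℂ)}ᶜ,
      ‖(t - w) / (1 - w * conj t)‖ * (‖kap a w‖ * ‖g‖) < ‖g w‖ :=
    (hc.eventually_lt_const (by simpa using hg)).filter_mono nhdsWithin_le_nhds
  have hball : ∀ᶠ t : ℂ in nhdsWithin (w : ℂ) {(w : ℂ)}ᶜ, ‖t‖ < 1 :=
    (continuous_norm.continuousAt.eventually_lt_const w.norm_lt_one).filter_mono nhdsWithin_le_nhds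
  obtain ⟨t, ht, htb, htw⟩ := (hlt.and (hball.and self_mem_nhdsWithin)).exists
  have := hb (UnitDisc.mk t htb) (by
    rintro rfl
    simp at htw)
  rw [coe_moebius, UnitDisc.coe_mk] at this
  exact ht.not_ge this

/-- If some function vanishes on `Z` but not at `v`, then `Z` is a zero set: the extremal function
at `v` has no zeros outside `Z`. -/
theorem isZeroSet_of_apply_ne_zero (ha1 : a ≤ 1) {Z : Set 𝔻} {f : DirichletSpace a}
    (hf : f ∈ vanishing a Z) {v : 𝔻} (hv : f v ≠ 0) : IsZeroSet (DirichletSpace a) Z := by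
  have hF : extremal a Z v ≠ 0 := by
    intro h
    have := inner_extremal (w := v) hf
    rw [h, inner_zero_left] at this
    exact hv this.symm
  refine ⟨fun h => hv (hf v (h ▸ mem_univ v)), extremal a Z v, hF, ?_⟩
  refine Subset.antisymm (fun z hz => extremal_mem z hz) fun u hu => ?_
  by_contra huZ
  -- The quotient `h` still vanishes on `Z`, so reproducing gives `‖h v‖ ≤ ‖F‖ ^ 2` for the extremal
  -- function `F`. But `‖F‖ ^ 2 = F v = moebius u v * h v` with a factor of modulus less than one.
  obtain ⟨h, hh, hn⟩ := exists_eq_moebius_mul ha1 (show extremal a Z v u = 0 from hu)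
  have hhZ : h ∈ vanishing a Z := by
    intro z hz
    have h1 := extremal_mem (a := a) (w := v) z hz
    rw [hh] at h1
    refine (mul_eq_zero.1 h1).resolve_left fun h2 => huZ ?_
    rwa [← coe_moebius_eq_zero.1 h2]
  have h1 : ‖h v‖ ≤ ‖extremal a Z v‖ * ‖extremal a Z v‖ := by
    rw [← inner_extremal hhZ]
    exact (norm_inner_le_norm _ _).trans (by gcongr)
  have h2 := congrArg norm (hh v)
  rw [extremal_apply_self, norm_mul, norm_pow, Complex.norm_real, norm_norm] at h2
  have h3 : 0 < ‖extremal a Z v‖ := norm_pos_iff.2 hF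
  have h4 := mul_le_mul_of_nonneg_left h1 (norm_nonneg (moebius u v : ℂ))
  have h5 := mul_lt_mul_of_pos_right (moebius u v).norm_lt_one (mul_pos h3 h3)
  nlinarith

/-- If a non-zero function vanishes on `Z`, then some function vanishes on `Z` but not at a given
other point. -/
theorem exists_mem_vanishing_apply_ne_zero (ha1 : a ≤ 1) {Z : Set 𝔻} {w : 𝔻} (hw : w ∉ Z)
    {f : DirichletSpace a} (hf : f ∈ vanishing a Z) (hf0 : f ≠ 0) :
    ∃ g ∈ vanishing a Z, g w ≠ 0 := by
  by_contra! H
  obtain ⟨v, hv⟩ : ∃ v, f v ≠ 0 := by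
    by_contra! h
    exact hf0 (RKHS.ext fun x => by simp [h x])
  -- If every function vanishing on `Z` also vanished at `w`, division could be repeated forever
  -- without increasing the norm, forcing `f v = 0`.
  have hdiv : ∀ n : ℕ, ∃ g ∈ vanishing a Z, f v = (moebius w v : ℂ) ^ n * g v ∧ ‖g‖ ≤ ‖f‖ := by
    intro n
    induction n with
    | zero => exact ⟨f, hf, by simp, le_rfl⟩
    | succ n ih =>
      obtain ⟨g, hg, hgv, hgn⟩ := ih
      obtain ⟨h, hh, hhn⟩ := exists_eq_moebius_mul ha1 (H g hg)
      refine ⟨h, fun z hz => ?_, ?_, hhn.trans hgn⟩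
      · have h1 := hg z hz
        rw [hh] at h1
        refine (mul_eq_zero.1 h1).resolve_left fun h2 => hw ?_
        rwa [← coe_moebius_eq_zero.1 h2]
      · rw [hgv, hh, pow_succ, mul_assoc]
  have hlim : Filter.Tendsto (fun n : ℕ => ‖(moebius w v : ℂ)‖ ^ n * (‖kap a v‖ * ‖f‖))
      Filter.atTop (nhds (0 * (‖kap a v‖ * ‖f‖))) :=
    (tendsto_pow_atTop_nhds_zero_of_lt_one (norm_nonneg _)
      (moebius w v).norm_lt_one).mul_const _
  rw [zero_mul] at hlim
  have := ge_of_tendsto' hlim fun n => by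
    obtain ⟨g, -, hgv, hgn⟩ := hdiv n
    calc ‖f v‖ = ‖(moebius w v : ℂ)‖ ^ n * ‖g v‖ := by rw [hgv, norm_mul, norm_pow]
      _ ≤ _ := by
        gcongr
        exact (norm_apply_le_kap g v).trans (by gcongr)
  exact hv (norm_le_zero_iff.1 this)

/-- A function that vanishes on `Z` but not at `w` yields a contractive multiplier that does. -/
theorem exists_isContractive (ha1 : a ≤ 1) {Z : Set 𝔻} {w : 𝔻} {g : DirichletSpace a}
    (hg : g ∈ vanishing a Z) (hgw : g w ≠ 0) :
    ∃ ε : ℝ, 0 < ε ∧ ∃ φ : 𝔻 → ℂ, IsContractive a φ ∧ φ w = ε ∧ ∀ z ∈ Z, φ z = 0 := by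
  obtain ⟨f, hf, -⟩ := (isConformal_moebius w).exists_comp g
  set Y := moebius w ⁻¹' Z
  have hfY : f ∈ vanishing a Y := fun z hz => by rw [hf, hg _ hz, mul_zero]
  have hf0 : f 0 ≠ 0 := by
    rw [hf, moebius_zero]
    exact mul_ne_zero (weight_ne_zero _ _) hgw
  have hF : extremal a Y 0 ≠ 0 := by
    intro h
    have := inner_extremal (w := 0) hfY
    rw [h, inner_zero_left] at this
    exact hf0 this.symm
  have hFn := norm_pos_iff.2 hF
  -- The extremal function has value `‖extremal a Y 0‖ ^ 2` at the origin, so its normalization has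
  -- value `‖extremal a Y 0‖` there; `moebius w` sends `w` to the origin.
  refine ⟨‖extremal a Y 0‖, hFn, _,
    (isContractive_extremal ha1 hF).comp (isConformal_moebius w), ?_, fun z hz => ?_⟩
  · have : (‖extremal a Y 0‖ : ℂ) ≠ 0 := by exact_mod_cast hFn.ne'
    simp only [Function.comp_apply, moebius_self, extremal_apply_self, Complex.ofReal_inv]
    field_simp
  · simp only [Function.comp_apply]
    rw [extremal_mem (moebius w z) (by simpa [Y, moebius_moebius] using hz), mul_zero]

/-! ## Orbits -/

theorem mem_orbit_self (G : Subgroup discAut) (w : 𝔻) : w ∈ orbit G w := ⟨1, G.one_mem, rfl⟩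

theorem inv_apply_mem_orbit {G : Subgroup discAut} {w z : 𝔻} {θ : discAut} (hθ : θ ∈ G)
    (hz : z ∈ orbit G w) : ((θ⁻¹ : discAut) : 𝔻 ≃ₜ 𝔻) z ∈ orbit G w := by
  obtain ⟨η, hη, rfl⟩ := hz
  exact ⟨θ⁻¹ * η, G.mul_mem (G.inv_mem hθ) hη, rfl⟩

/-- Only `w` has to be separated from the rest of the orbit. Since `θ⁻¹` permutes the orbit, `φ ∘
θ⁻¹` separates `θ w` with the same `ε`, which gives uniformity. -/
theorem isStronglySeparated_orbit_of_isZeroSet (ha1 : a ≤ 1) {G : Subgroup discAut} {w : 𝔻}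
    (h : IsZeroSet (DirichletSpace a) (orbit G w)) :
    IsStronglySeparated (DirichletSpace a) (orbit G w) := by
  obtain ⟨-, f, hf0, hfZ⟩ := h
  have hf : f ∈ vanishing a (orbit G w \ {w}) := fun z hz => hfZ.subset hz.1
  obtain ⟨g, hg, hgw⟩ := exists_mem_vanishing_apply_ne_zero ha1 (fun hw => hw.2 rfl) hf hf0
  obtain ⟨ε, hε, φ, hφ, hφw, hφZ⟩ := exists_isContractive ha1 hg hgw
  refine ⟨ε, hε, ?_⟩
  rintro z ⟨θ, hθ, rfl⟩
  have hc := hφ.comp (isConformal_discAut θ⁻¹)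
  refine ⟨_, hc.isMultiplier, hc.multiplierNorm_le, ?_, fun u hu huz => ?_⟩
  · rw [Function.comp_apply, ← hφw]
    congr 1
    exact (θ : 𝔻 ≃ₜ 𝔻).symm_apply_apply w
  · refine hφZ _ ⟨inv_apply_mem_orbit hθ hu, fun h => huz ?_⟩
    rw [mem_singleton_iff] at h
    rw [← h]
    exact ((θ : 𝔻 ≃ₜ 𝔻).apply_symm_apply u).symm

theorem isZeroSet_of_isStronglySeparated (ha0 : 0 < a) (ha1 : a ≤ 1) {Z : Set 𝔻} {w : 𝔻}
    (hw : w ∈ Z) (h : IsStronglySeparated (DirichletSpace a) Z) :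
    IsZeroSet (DirichletSpace a) Z := by
  obtain ⟨ε, hε, h⟩ := h
  obtain ⟨φ, hφ, -, hφw, hφZ⟩ := h w hw
  -- `kap a 0` is the constant function one, so `φ` itself belongs to the space.
  obtain ⟨g, hg⟩ := hφ (kap a 0)
  have hgφ : ∀ x, g x = φ x := fun x => by
    rw [hg, kap_apply, dirichletKernel_zero_right, mul_one]
  -- The factor `x - w` used below kills the value at `w`, so a second point where `g` is non-zero
  -- is needed.
  obtain ⟨v, hvw, hgv⟩ := exists_ne_apply_ne_zero ha1 (g := g) (w := w) (by
    rw [hgφ, hφw]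
    exact_mod_cast hε.ne')
  obtain ⟨k, hk⟩ := exists_coord_mul ha0 ha1 g
  have hf : ∀ x, (k - (w : ℂ) • g) x = (x - w) * g x := fun x => by
    simp [hk, sub_mul]
  refine isZeroSet_of_apply_ne_zero ha1 (f := k - (w : ℂ) • g) (v := v) (fun z hz => ?_) ?_
  · rw [hf]
    rcases eq_or_ne z w with rfl | hzw
    · simp
    · rw [hgφ, hφZ z hz hzw, mul_zero]
  · rw [hf]
    exact mul_ne_zero (sub_ne_zero.2 fun h => hvw (UnitDisc.coe_injective h)) hgv

end FuchsianZero

end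

theorem mainTheorem5 (a : ℝ≥0) (ha0 : 0 < a) (ha1 : a ≤ 1)
    (G : Subgroup FuchsianZero.discAut) (hG : FuchsianZero.IsFuchsian G) (w : 𝔻) :
    FuchsianZero.IsZeroSet (FuchsianZero.DirichletSpace a) (FuchsianZero.orbit G w) ↔
      FuchsianZero.IsStronglySeparated (FuchsianZero.DirichletSpace a)
        (FuchsianZero.orbit G w) :=
  ⟨FuchsianZero.isStronglySeparated_orbit_of_isZeroSet ha1,
    FuchsianZero.isZeroSet_of_isStronglySeparated ha0 ha1 (FuchsianZero.mem_orbit_self G w)⟩
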